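/- Let $G$ be a directed graph with a nonempty, finite or countable vertex set $V(G)$ and a finite or countable edge set $E(G)$ (loops and multiple edges are allowed). Let $\mathbb{F}^+(G)$ be the set of all vertices (regarded as paths of length $0$) and all finite directed paths of $G$, where $uw$ denotes the path $w$ followed by the path $u$, defined when $w$ ends where $u$ begins. Let $\mathcal{H}_G=\ell^2(\mathbb{F}^+(G))$ with orthonormal basis $\{\xi_w\}_{w\in\mathbb{F}^+(G)}$. For $u\in E(G)\cup V(G)$ let $L_u$ be the bounded operator on $\mathcal{H}_G$ with $L_u\xi_w=\xi_{uw}$ if $uw$ is defined, and $L_u\xi_w=0$ otherwise. The quiver algebra $\mathcal{A}_G$ is the norm closed (not necessarily unital) algebra generated by $\{L_e,L_x : e\in E(G),\ x\in V(G)\}$, and $C^*(\mathcal{A}_G)\subseteq\mathcal{B}(\mathcal{H}_G)$ is the $\mathrm{C}^*$-algebra generated by $\mathcal{A}_G$. Let $\mathcal{A}_2$ be the quiver algebra of the graph with one vertex and two distinct loop edges. Call $\mathcal{A}_G$ *unitally partly free* if there is an injective $*$-homomorphism $\varphi : C^*(\mathcal{A}_2)\to C^*(\mathcal{A}_G)$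 with $\varphi(\mathcal{A}_2)\subseteq\mathcal{A}_G$ and $\varphi(I)=I$. A *cycle* at a vertex $x$ is a path of at least one edge from $x$ to $x$ of which only the initial edge has source $x$; a *double-cycle* at $x$ is a pair of distinct cycles at $x$. The *saturation* at a vertex $x$ consists of $x$, all finite and infinite paths starting at $x$, and all final vertices of paths starting at $x$; it includes a double-cycle if there is a double-cycle at some vertex belonging to it. **Theorem.** The following are equivalent: (i) $G$ has finitely many vertices, and the saturation at every vertex of $G$ includes a double-cycle; (ii) $\mathcal{A}_G$ is unitally partly free; (iii) there are isometries $U,V\in\mathcal{A}_G$ with $U^*V=0$. -/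

import Mathlib

universe u v

open scoped lp

noncomputable section

namespace QuiverAlg

/-! ### The free semigroupoid of a directed graph

A directed graph is a quiver: a type `V` of vertices and, for vertices `a b`, a type `a ⟶ b` of
edges with source `a` and final vertex `b`; parallel edges and loops are allowed. -/

/-- The free semigroupoid of the directed graph `V`: the vertices (the paths of length `0`)
together with all finite directed paths. -/
structure FreeSemigroupoid (V : Type u) [Quiver.{v} V] : Type (max u v) where
  source : V
  target : V
  path : Quiver.Path source target

namespace FreeSemigroupoid

variable {V : Type u} [Quiver.{v} V]

/-- The vertex `x`, as a unit of the free semigroupoid. -/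
def ofVertex (x : V) : FreeSemigroupoid V := ⟨x, x, Quiver.Path.nil⟩

/-- The edge `e`, as a path of length one. -/
def ofEdge {a b : V} (e : a ⟶ b) : FreeSemigroupoid V := ⟨a, b, e.toPath⟩

open Classical in
/-- The partially defined product `u w`: first traverse `w`, then `u`. It is defined when the final
vertex of `w` is the initial vertex of `u`. -/
def mul (u w : FreeSemigroupoid V) : Option (FreeSemigroupoid V) :=
  if h : w.target = u.source then
    some ⟨w.source, u.target, (w.path.cast rfl h).comp u.path⟩
  else none

theorem mul_left_cancel (u w w' z : FreeSemigroupoid V)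
    (h : mul u w = some z) (h' : mul u w' = some z) : w = w' := by
  obtain ⟨a, b, p⟩ := u
  obtain ⟨c, d, q⟩ := w
  obtain ⟨c', d', q'⟩ := w'
  unfold mul at h h'
  split_ifs at h with h₁
  split_ifs at h' with h₂
  dsimp only at h₁ h₂
  subst h₁
  subst h₂
  rw [← h'] at h
  simp only [Option.some.injEq, FreeSemigroupoid.mk.injEq] at h
  obtain ⟨rfl, -, h⟩ := h
  simpa using h

end FreeSemigroupoid

/-! ### Operators on `ℓ²` given by partially defined injections of the index set -/

section PartialShift

variable {ι : Type u} (m : ι → Option ι)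

open Classical in
/-- The sequence whose entry at `j` is `x i` if `m i = j`, and `0` if `j` is not a value of `m`. -/
def shiftFun (x : ι → ℂ) (j : ι) : ℂ :=
  if h : ∃ i, m i = some j then x h.choose else 0

variable {m}

theorem shiftFun_apply (hm : ∀ i i' j, m i = some j → m i' = some j → i = i') (x : ι → ℂ)
    {i j : ι} (h : m i = some j) : shiftFun m x j = x i := by
  have h' : ∃ i, m i = some j := ⟨i, h⟩
  rw [shiftFun, dif_pos h', hm _ _ _ h'.choose_spec h]

theorem shiftFun_apply_of_not (x : ι → ℂ) {j : ι} (h : ¬ ∃ i, m i = some j) :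
    shiftFun m x j = 0 := by
  rw [shiftFun, dif_neg h]

theorem sum_shiftFun_le (hm : ∀ i i' j, m i = some j → m i' = some j → i = i')
    (x : ℓ²(ι, ℂ)) (s : Finset ι) :
    ∑ j ∈ s, ‖shiftFun m x j‖ ^ (2 : ENNReal).toReal ≤ ‖x‖ ^ (2 : ENNReal).toReal := by
  classical
  set t := s.filter (fun j => ∃ i, m i = some j) with ht
  have h1 : ∑ j ∈ s, ‖shiftFun m x j‖ ^ (2 : ENNReal).toReal
      = ∑ j ∈ t, ‖shiftFun m x j‖ ^ (2 : ENNReal).toReal := by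
    rw [ht, Finset.sum_filter]
    refine Finset.sum_congr rfl fun j _ => ?_
    split_ifs with h
    · rfl
    · rw [shiftFun_apply_of_not _ h]; simp
  have hex : ∀ j ∈ t, ∃ i, m i = some j := fun j hj => (Finset.mem_filter.1 hj).2
  choose! g hg using hex
  have hinj : Set.InjOn g t := by
    intro j hj j' hj' hjj
    have h2 := hg j hj
    rw [hjj, hg j' hj'] at h2
    exact (Option.some.inj h2).symm
  have h2 : ∑ j ∈ t, ‖shiftFun m x j‖ ^ (2 : ENNReal).toReal
      = ∑ i ∈ t.image g, ‖x i‖ ^ (2 : ENNReal).toReal := by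
    rw [Finset.sum_image hinj]
    refine Finset.sum_congr rfl fun j hj => ?_
    rw [shiftFun_apply hm _ (hg j hj)]
  rw [h1, h2]
  exact lp.sum_rpow_le_norm_rpow (by norm_num) x _

/-- The bounded operator on `ℓ²(ι)` with `ξ_i ↦ ξ_{m i}` where `m i` is defined and `ξ_i ↦ 0`
elsewhere, for a partially defined injection `m` (see `partialShift_single_some` and
`partialShift_single_none`). -/
def partialShift (m : ι → Option ι) (hm : ∀ i i' j, m i = some j → m i' = some j → i = i') :
    ℓ²(ι, ℂ) →L[ℂ] ℓ²(ι, ℂ) :=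
  LinearMap.mkContinuous
    { toFun := fun x => ⟨shiftFun m x, memℓp_gen' (sum_shiftFun_le hm x)⟩
      map_add' := by
        intro x y
        ext j
        simp only [shiftFun, lp.coeFn_add, Pi.add_apply]
        split_ifs <;> simp
      map_smul' := by
        intro c x
        ext j
        simp only [shiftFun, lp.coeFn_smul, Pi.smul_apply, RingHom.id_apply]
        split_ifs <;> simp }
    1 (by
      intro x
      rw [one_mul]
      exact lp.norm_le_of_forall_sum_le (by norm_num) (norm_nonneg _) (sum_shiftFun_le hm x))

theorem partialShift_apply (hm : ∀ i i' j, m i = some j → m i' = some j → i = i')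
    (x : ℓ²(ι, ℂ)) (j : ι) : partialShift m hm x j = shiftFun m x j := rfl

open Classical in
theorem partialShift_single_some (hm : ∀ i i' j, m i = some j → m i' = some j → i = i')
    {i j : ι} (h : m i = some j) :
    partialShift m hm (lp.single 2 i 1) = lp.single 2 j 1 := by
  ext k
  rw [partialShift_apply]
  by_cases hk : ∃ i', m i' = some k
  · obtain ⟨i', hi'⟩ := hk
    rw [shiftFun_apply hm _ hi']
    by_cases hii : i' = i
    · subst hii
      obtain rfl : j = k := Option.some.inj (h.symm.trans hi')
      simp
    · have hjk : k ≠ j := fun hjk => hii (hm _ _ _ hi' (hjk ▸ h))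
      simp [hii, hjk]
  · rw [shiftFun_apply_of_not _ hk]
    have hjk : k ≠ j := fun hjk => hk ⟨i, hjk ▸ h⟩
    simp [hjk]

open Classical in
theorem partialShift_single_none (hm : ∀ i i' j, m i = some j → m i' = some j → i = i')
    {i : ι} (h : m i = none) :
    partialShift m hm (lp.single 2 i 1) = 0 := by
  ext k
  rw [partialShift_apply]
  by_cases hk : ∃ i', m i' = some k
  · obtain ⟨i', hi'⟩ := hk
    rw [shiftFun_apply hm _ hi']
    have hii : i' ≠ i := fun hii => by simp [hii, h] at hi'
    simp [hii]
  · rw [shiftFun_apply_of_not _ hk]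
    simp

end PartialShift

/-! ### The quiver algebra -/

/-- The Fock space `H_G`: the Hilbert space with orthonormal basis indexed by the free
semigroupoid. -/
abbrev Fock (V : Type u) [Quiver.{v} V] : Type (max u v) := ℓ²(FreeSemigroupoid V, ℂ)

section

variable (V : Type u) [Quiver.{v} V]

variable {V} in
/-- The left regular representation: `L u` maps `ξ_w` to `ξ_{u w}` if `u w` is an allowable path,
and to `0` otherwise. -/
def L (u : FreeSemigroupoid V) : Fock V →L[ℂ] Fock V :=
  partialShift (FreeSemigroupoid.mul u) (FreeSemigroupoid.mul_left_cancel u)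

/-- The generators: the partial creation operators `L_e` of the edges and the projections `L_x` of
the vertices. -/
def generators : Set (Fock V →L[ℂ] Fock V) :=
  {T | ∃ (a b : V) (e : a ⟶ b), T = L (FreeSemigroupoid.ofEdge e)} ∪
    {T | ∃ x : V, T = L (FreeSemigroupoid.ofVertex x)}

/-- The quiver algebra: the norm closed (not necessarily unital) algebra of operators generated
by the `L_e` and `L_x`. -/
def quiverAlgebra : NonUnitalSubalgebra ℂ (Fock V →L[ℂ] Fock V) :=
  (NonUnitalAlgebra.adjoin ℂ (generators V)).topologicalClosure

/-- The C*-algebra of operators on the Fock space generated by the quiver algebra. -/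
def generatedCStarAlgebra : NonUnitalStarSubalgebra ℂ (Fock V →L[ℂ] Fock V) :=
  (NonUnitalStarAlgebra.adjoin ℂ
    (quiverAlgebra V : Set (Fock V →L[ℂ] Fock V))).topologicalClosure

/-- The directed graph with one vertex and two distinct loop edges; its quiver algebra is the
noncommutative disc algebra. -/
abbrev TwoLoops : Type := Quiver.SingleObj (Fin 2)

/-- The quiver algebra of `V` is unitally partly free: there is an injective *-homomorphism from
the C*-algebra generated by the noncommutative disc algebra to the C*-algebra generated by the
quiver algebra of `V` which restricts to a map of the noncommutative disc algebra into the quiver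
algebra of `V` and which maps the identity operator to the identity operator. -/
def IsUnitallyPartlyFree : Prop :=
  ∃ φ : generatedCStarAlgebra TwoLoops →⋆ₙₐ[ℂ] generatedCStarAlgebra V,
    Function.Injective φ ∧
    (∀ T : generatedCStarAlgebra TwoLoops,
      (T : Fock TwoLoops →L[ℂ] Fock TwoLoops) ∈ quiverAlgebra TwoLoops →
        (φ T : Fock V →L[ℂ] Fock V) ∈ quiverAlgebra V) ∧
    ∃ I : generatedCStarAlgebra TwoLoops,
      (I : Fock TwoLoops →L[ℂ] Fock TwoLoops) = 1 ∧ (φ I : Fock V →L[ℂ] Fock V) = 1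

end

/-! ### Double-cycles and saturations -/

section

variable {V : Type u} [Quiver.{v} V]

/-- A cycle at `x` is a path of (at least one) edges from `x` to `x` for which only the initial
edge has source `x`: if the path is `q`, then an edge `e` with source `x`, then `r`, then `q` is
empty. -/
def IsCycleAt {x : V} (w : Quiver.Path x x) : Prop :=
  0 < w.length ∧
    ∀ (y : V) (q : Quiver.Path x x) (e : x ⟶ y) (r : Quiver.Path y x),
      w = (q.cons e).comp r → q.length = 0

/-- There is a double-cycle at `x`: two distinct cycles at `x`. -/
def HasDoubleCycleAt (x : V) : Prop :=
  ∃ w₁ w₂ : Quiver.Path x x, IsCycleAt w₁ ∧ IsCycleAt w₂ ∧ w₁ ≠ w₂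

/-- The vertices of the saturation at `x`: `x` itself and the final vertices of the finite paths
that start at `x`. (The edges of the saturation are those on paths which start at `x`, which are
exactly the edges whose source belongs to this set.) -/
def satVertices (x : V) : Set V := {y | Nonempty (Quiver.Path x y)}

/-- The saturation at `x` includes a double-cycle. A cycle at a vertex of the saturation runs
entirely inside the saturation. -/
def SatIncludesDoubleCycle (x : V) : Prop := ∃ y ∈ satVertices x, HasDoubleCycleAt y

end

/-- Every vertex saturation includes a double-cycle. -/
def UniformDoubleCycleProperty (V : Type u) [Quiver.{v} V] : Prop :=
  ∀ x : V, SatIncludesDoubleCycle x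

end QuiverAlg

end

open scoped lp

noncomputable section

namespace QuiverAlg

/-! ### The standard basis of `ℓ²` -/

section Basis

variable {ι : Type*} {κ : Type*}

/-! From double-cycles to partly free: for each vertex `x` choose a path `p x` to a vertex carrying
distinct cycles `c`, `d`, and let `u i x` be `p x`, then `d`, then a power of `c` whose exponent is
different for each pair `(i, x)`. With finitely many vertices, `S i = ∑ x, L (u i x)` lies in the
algebra and permutes basis vectors through `σ i`, which appends `u i x` to a path ending at `x`.
Reading a path backwards recovers the exponent, hence `i` and `x` (`comp_loopPow_inj`), so `σ 0` and
`σ 1` are injective with disjoint ranges. They also lengthen paths, so every path is uniquely a word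
in them applied to a path in neither range. The Fock space is thereby a Hilbert sum of copies of the
two-loop Fock space, with `S i` the amplification of the `i`-th creation operator. Amplification is
the required homomorphism (`isUnitallyPartlyFree_of_shifts`). The images of the two creation
operators then give the isometries of (iii).

Back to the graph: polynomials in the generators kill every path ending outside a finite vertex set,
so an isometry in the closure forces finitely many vertices. If some saturation has no double-cycle,
then from some vertex `y` there is at most one path of each length (`exists_subsingleton_edges`),
and the paths from `y` of length less than `n` span dimension at most `n`. Polynomials close to two
isometries with orthogonal ranges would double this dimension each time `n` grows by a fixed amount
(`two_mul_finrank_pathSpan_le`): exponential against linear growth. -/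

open Classical in
/-- The standard basis vector of `ℓ²(ι)` at `i`. -/
def basisVec (i : ι) : ℓ²(ι, ℂ) := lp.single 2 i 1

open Classical in
theorem basisVec_apply (i j : ι) : basisVec i j = if j = i then 1 else 0 := by
  rw [basisVec, lp.single_apply, Pi.single_apply]

theorem norm_basisVec (i : ι) : ‖basisVec i‖ = 1 := by
  classical
  rw [basisVec, lp.norm_single (by norm_num), norm_one]

theorem inner_basisVec (i : ι) (f : ℓ²(ι, ℂ)) : inner ℂ (basisVec i) f = f i := by
  classical
  rw [basisVec, lp.inner_single_left]
  simp

theorem orthonormal_basisVec : Orthonormal ℂ (basisVec : ι → ℓ²(ι, ℂ)) := by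
  classical
  rw [orthonormal_iff_ite]
  intro i j
  rw [inner_basisVec, basisVec_apply]

theorem hasSum_basisVec (f : ℓ²(ι, ℂ)) : HasSum (fun i => f i • basisVec i) f := by
  classical
  refine (lp.hasSum_single (by norm_num) f).congr_fun ?_
  intro i
  rw [basisVec, ← lp.single_smul, smul_eq_mul, mul_one]

theorem span_basisVec_topologicalClosure :
    (Submodule.span ℂ (Set.range (basisVec : ι → ℓ²(ι, ℂ)))).topologicalClosure = ⊤ := by
  refine eq_top_iff.2 fun f _ => ?_
  refine mem_closure_of_tendsto (hasSum_basisVec f) (Filter.Eventually.of_forall fun s => ?_)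
  exact sum_mem fun i _ => Submodule.smul_mem _ _ (Submodule.subset_span ⟨i, rfl⟩)

theorem clm_ext_basisVec {F : Type*} [NormedAddCommGroup F] [NormedSpace ℂ F]
    {A B : ℓ²(ι, ℂ) →L[ℂ] F} (h : ∀ i, A (basisVec i) = B (basisVec i)) : A = B := by
  ext f
  have hA := A.hasSum (hasSum_basisVec f)
  have hB := B.hasSum (hasSum_basisVec f)
  simp only [map_smul, h] at hA hB
  exact hA.unique hB

/-- The isometric inclusion of `ℓ²` spaces induced by an injection of the index sets. -/
def inclusion (g : ι → κ) (hg : Function.Injective g) : ℓ²(ι, ℂ) →ₗᵢ[ℂ] ℓ²(κ, ℂ) :=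
  (orthonormal_basisVec.comp g hg).orthogonalFamily.linearIsometry

theorem inclusion_basisVec (g : ι → κ) (hg : Function.Injective g) (i : ι) :
    inclusion g hg (basisVec i) = basisVec (g i) := by
  classical
  rw [inclusion, basisVec, OrthogonalFamily.linearIsometry_apply_single]
  simp

end Basis

/-! ### Amplification of operators -/

section Amplification

variable {R G E : Type*} [NormedAddCommGroup G] [InnerProductSpace ℂ G] [NormedAddCommGroup E] [InnerProductSpace ℂ E] [CompleteSpace E] {W : R → G →ₗᵢ[ℂ] E}

/-- The operator acting as `T` on every summand of the Hilbert sum of copies of `G`. -/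
def diagonal (R : Type*) (T : G →L[ℂ] G) : lp (fun _ : R => G) 2 →L[ℂ] lp (fun _ : R => G) 2 :=
  lp.mapCLM 2 (fun _ => T) (norm_nonneg T) (fun _ => le_rfl)

theorem diagonal_apply (T : G →L[ℂ] G) (f : lp (fun _ : R => G) 2) (r : R) :
    diagonal R T f r = T (f r) := rfl

variable [CompleteSpace G]

/-- The *-homomorphism `T ↦ T ⊗ 1`, for a Hilbert space that is a Hilbert sum of copies of `G`. -/
def amplification (hW : IsHilbertSum ℂ (fun _ : R => G) W) :
    (G →L[ℂ] G) →⋆ₙₐ[ℂ] (E →L[ℂ] E) where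
  toFun T := (hW.linearIsometryEquiv.symm.toContinuousLinearEquiv :
      lp (fun _ : R => G) 2 →L[ℂ] E) ∘L diagonal R T ∘L
      (hW.linearIsometryEquiv.toContinuousLinearEquiv : E →L[ℂ] lp (fun _ : R => G) 2)
  map_smul' c T := by
    ext x
    refine hW.linearIsometryEquiv.injective ?_
    ext r
    simp [diagonal_apply]
  map_zero' := by
    ext x
    refine hW.linearIsometryEquiv.injective ?_
    ext r
    simp [diagonal_apply]
  map_add' S T := by
    ext x
    refine hW.linearIsometryEquiv.injective ?_
    ext r
    simp [diagonal_apply]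
  map_mul' S T := by
    ext x
    refine hW.linearIsometryEquiv.injective ?_
    ext r
    simp [diagonal_apply]
  map_star' T := by
    rw [ContinuousLinearMap.star_eq_adjoint, ContinuousLinearMap.star_eq_adjoint,
      ContinuousLinearMap.eq_adjoint_iff]
    intro x y
    rw [← hW.linearIsometryEquiv.inner_map_map, ← hW.linearIsometryEquiv.inner_map_map x]
    simp [lp.inner_eq_tsum, diagonal_apply, ContinuousLinearMap.adjoint_inner_left]

theorem amplification_apply (hW : IsHilbertSum ℂ (fun _ : R => G) W) (T : G →L[ℂ] G) (r : R)
    (x : G) : amplification hW T (W r x) = W r (T x) := by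
  classical
  have key (y : G) : hW.linearIsometryEquiv (W r y) = lp.single 2 r y := by
    rw [← hW.linearIsometryEquiv_symm_apply_single, LinearIsometryEquiv.apply_symm_apply]
  refine hW.linearIsometryEquiv.injective ?_
  ext s
  by_cases h : s = r
  · subst h; simp [amplification, diagonal_apply, key]
  · simp [amplification, diagonal_apply, key, h]

theorem amplification_injective [Nonempty R] (hW : IsHilbertSum ℂ (fun _ : R => G) W) :
    Function.Injective (amplification hW) := by
  intro S T h
  ext x
  have r : R := Classical.arbitrary R
  refine (W r).injective ?_
  rw [← amplification_apply hW, ← amplification_apply hW, h]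

theorem amplification_one (hW : IsHilbertSum ℂ (fun _ : R => G) W) :
    amplification hW 1 = 1 := by
  ext x
  refine hW.linearIsometryEquiv.injective ?_
  ext r
  simp [amplification, diagonal_apply]

end Amplification

/-- A partition of the index set `κ` into copies of `ι` exhibits `ℓ²(κ)` as a Hilbert sum of copies
of `ℓ²(ι)`. -/
theorem isHilbertSum_inclusion {ι R κ : Type*} (g : R → ι → κ)
    (hi : ∀ r, Function.Injective (g r))
    (hg : Function.Bijective fun p : R × ι => g p.1 p.2) :
    IsHilbertSum ℂ (fun _ : R => ℓ²(ι, ℂ)) fun r => inclusion (g r) (hi r) := by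
  refine IsHilbertSum.mk ?_ ?_
  · intro r s hrs x y
    -- Orthogonality is tested on basis vectors one slot at a time, each time as the vanishing of a
    -- bounded linear functional.
    have h1 (i : ι) : inner ℂ (inclusion (g r) (hi r) (basisVec i)) (inclusion (g s) (hi s) y) = 0 := by
      have : (innerSL ℂ (inclusion (g r) (hi r) (basisVec i))) ∘L
          (inclusion (g s) (hi s)).toContinuousLinearMap = 0 := by
        refine clm_ext_basisVec fun j => ?_
        have hne : g r i ≠ g s j := fun h =>
          hrs (Prod.ext_iff.1 (hg.1 (a₁ := (r, i)) (a₂ := (s, j)) h)).1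
        simp [inclusion_basisVec, inner_basisVec, basisVec_apply, hne]
      simpa using DFunLike.congr_fun this y
    have h2 : (innerSL ℂ (inclusion (g s) (hi s) y)) ∘L
          (inclusion (g r) (hi r)).toContinuousLinearMap = 0 := by
      refine clm_ext_basisVec fun j => ?_
      simpa using inner_eq_zero_symm.1 (h1 j)
    exact inner_eq_zero_symm.1 (by simpa using DFunLike.congr_fun h2 x)
  · rw [← span_basisVec_topologicalClosure]
    refine Submodule.topologicalClosure_mono (Submodule.span_le.2 ?_)
    rintro _ ⟨k, rfl⟩
    obtain ⟨⟨r, i⟩, rfl⟩ := hg.2 k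
    refine Submodule.mem_iSup_of_mem r ⟨basisVec i, ?_⟩
    exact inclusion_basisVec (g r) (hi r) i

/-! ### The left regular representation on the standard basis -/

section LeftRegular

variable {V : Type u} [Quiver.{v} V]

theorem L_basisVec_of_some {u w z : FreeSemigroupoid V} (h : FreeSemigroupoid.mul u w = some z) :
    L u (basisVec w) = basisVec z :=
  partialShift_single_some _ h

theorem L_basisVec_of_none {u w : FreeSemigroupoid V} (h : FreeSemigroupoid.mul u w = none) :
    L u (basisVec w) = 0 :=
  partialShift_single_none _ h

namespace FreeSemigroupoid

theorem mul_mk {a b c : V} (p : Quiver.Path a b) (q : Quiver.Path b c) :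
    mul ⟨b, c, q⟩ ⟨a, b, p⟩ = some ⟨a, c, p.comp q⟩ := by
  simp [mul]

theorem mul_eq_none {u w : FreeSemigroupoid V} (h : w.target ≠ u.source) : mul u w = none := by
  simp [mul, h]

end FreeSemigroupoid

theorem L_mk_basisVec {a b c : V} (p : Quiver.Path a b) (q : Quiver.Path b c) :
    L ⟨b, c, q⟩ (basisVec ⟨a, b, p⟩) = basisVec ⟨a, c, p.comp q⟩ :=
  L_basisVec_of_some (FreeSemigroupoid.mul_mk p q)

theorem L_basisVec_of_ne {u w : FreeSemigroupoid V} (h : w.target ≠ u.source) :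
    L u (basisVec w) = 0 :=
  L_basisVec_of_none (FreeSemigroupoid.mul_eq_none h)

theorem L_ofVertex_mem (x : V) :
    L (FreeSemigroupoid.ofVertex x) ∈ NonUnitalAlgebra.adjoin ℂ (generators V) :=
  NonUnitalAlgebra.subset_adjoin ℂ (Or.inr ⟨x, rfl⟩)

theorem L_cons {a b c : V} (p : Quiver.Path a b) (e : b ⟶ c) :
    L ⟨a, c, p.cons e⟩ = L (FreeSemigroupoid.ofEdge e) * L ⟨a, b, p⟩ := by
  refine clm_ext_basisVec ?_
  rintro ⟨x, y, q⟩
  rw [mul_apply_eq_comp]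
  by_cases h : y = a
  · subst h
    rw [L_mk_basisVec, L_mk_basisVec, FreeSemigroupoid.ofEdge, L_mk_basisVec]
    rfl
  · rw [L_basisVec_of_ne h, L_basisVec_of_ne h, map_zero]

theorem L_mem {a b : V} (p : Quiver.Path a b) :
    L ⟨a, b, p⟩ ∈ NonUnitalAlgebra.adjoin ℂ (generators V) := by
  induction p with
  | nil => exact L_ofVertex_mem a
  | cons p e ih =>
    rw [L_cons]
    exact mul_mem (NonUnitalAlgebra.subset_adjoin ℂ (Or.inl ⟨_, _, e, rfl⟩)) ih

/-- Only the projection of the final vertex of a path fixes its basis vector; the others kill it.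
This puts the identity in the a priori non-unital algebra. -/
theorem sum_L_ofVertex [Fintype V] : ∑ x : V, L (FreeSemigroupoid.ofVertex x) = 1 := by
  classical
  refine clm_ext_basisVec ?_
  rintro ⟨a, b, p⟩
  rw [_root_.sum_apply, Finset.sum_eq_single b]
  · exact L_mk_basisVec p Quiver.Path.nil
  · intro x _ hx
    exact L_basisVec_of_ne hx.symm
  · simp

end LeftRegular

/-! ### Words in two injections with disjoint ranges -/

section Words

variable {J : Type*} (σ : Fin 2 → J → J)

/-- The action on `J` of the words in `σ 0` and `σ 1`. -/
def wordAction : ∀ {a b : TwoLoops}, Quiver.Path a b → J → J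
  | _, _, .nil => id
  | _, _, .cons p e => fun j => σ e (wordAction p j)

theorem wordAction_nil (a : TwoLoops) (j : J) :
    wordAction σ (Quiver.Path.nil : Quiver.Path a a) j = j := by
  simp only [wordAction, id]

theorem wordAction_cons {a b c : TwoLoops} (p : Quiver.Path a b) (e : b ⟶ c) (j : J) :
    wordAction σ (p.cons e) j = σ e (wordAction σ p j) := by
  simp only [wordAction]

/-- The elements of `J` outside the ranges of `σ 0` and `σ 1`. -/
abbrev Wandering : Type _ := {j : J // ∀ i k, σ i k ≠ j}

variable {σ}

/-- Peel off outermost letters: a value of `σ` determines its letter and its preimage, while a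
wandering element is no value at all, so both words run out together. -/
theorem wordAction_injective (hσ : ∀ i i' j j', σ i j = σ i' j' → i = i' ∧ j = j')
    {a b a' b' : TwoLoops} (p : Quiver.Path a b) (p' : Quiver.Path a' b') (r r' : Wandering σ)
    (h : wordAction σ p r = wordAction σ p' r') :
    r = r' ∧ (⟨a, b, p⟩ : FreeSemigroupoid TwoLoops) = ⟨a', b', p'⟩ := by
  obtain rfl : a = a' := rfl
  induction p generalizing b' with
  | nil =>
    cases p' with
    | nil =>
      rw [wordAction_nil, wordAction_nil] at h
      exact ⟨Subtype.ext h, rfl⟩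
    | cons p' e' =>
      rw [wordAction_nil, wordAction_cons] at h
      exact absurd h.symm (r.2 _ _)
  | cons p e ih =>
    cases p' with
    | nil =>
      rw [wordAction_nil, wordAction_cons] at h
      exact absurd h (r'.2 _ _)
    | cons p' e' =>
      rw [wordAction_cons, wordAction_cons] at h
      obtain ⟨he, hj⟩ := hσ _ _ _ _ h
      obtain ⟨rfl, hp⟩ := ih p' hj
      refine ⟨rfl, ?_⟩
      injection hp with _ h1 h2
      subst h2
      exact congrArg (fun x => (⟨a, _, p.cons x⟩ : FreeSemigroupoid TwoLoops)) he

/-- Stripping letters strictly lowers `len`, so it must stop, and it can stop only at a wandering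
element. -/
theorem wordAction_surjective (len : J → ℕ) (hlen : ∀ i j, len j < len (σ i j)) (j : J) :
    ∃ (r : Wandering σ) (w : FreeSemigroupoid TwoLoops), wordAction σ w.path r = j := by
  induction h : len j using Nat.strong_induction_on generalizing j with
  | _ n ih =>
    by_cases hj : ∀ i k, σ i k ≠ j
    · exact ⟨⟨j, hj⟩, FreeSemigroupoid.ofVertex (Quiver.SingleObj.star _), wordAction_nil σ _ j⟩
    · push Not at hj
      obtain ⟨i, k, rfl⟩ := hj
      obtain ⟨r, w, hw⟩ := ih _ (h ▸ hlen i k) k rfl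
      obtain ⟨a, b, p⟩ := w
      exact ⟨r, ⟨a, b, p.cons i⟩, (wordAction_cons σ p i r).trans (congrArg (σ i) hw)⟩

theorem wordAction_bijective (hσ : ∀ i i' j j', σ i j = σ i' j' → i = i' ∧ j = j')
    (len : J → ℕ) (hlen : ∀ i j, len j < len (σ i j)) :
    Function.Bijective
      fun p : Wandering σ × FreeSemigroupoid TwoLoops => wordAction σ p.2.path (p.1 : J) := by
  refine ⟨?_, fun j => ?_⟩
  · rintro ⟨r, w⟩ ⟨r', w'⟩ h
    obtain ⟨h1, h2⟩ := wordAction_injective hσ _ _ _ _ h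
    exact Prod.ext h1 h2
  · obtain ⟨r, w, h⟩ := wordAction_surjective len hlen j
    exact ⟨(r, w), h⟩

end Words

/-! ### Partly free quiver algebras from pairs of pure shifts -/

section PartlyFree

variable {V : Type u} [Quiver.{v} V]

theorem quiverAlgebra_le_generatedCStarAlgebra {T : Fock V →L[ℂ] Fock V}
    (hT : T ∈ quiverAlgebra V) : T ∈ generatedCStarAlgebra V :=
  NonUnitalStarSubalgebra.le_topologicalClosure _ (NonUnitalStarAlgebra.subset_adjoin ℂ _ hT)

theorem one_mem_quiverAlgebra [Finite V] : (1 : Fock V →L[ℂ] Fock V) ∈ quiverAlgebra V := by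
  have := Fintype.ofFinite V
  rw [← sum_L_ofVertex]
  exact sum_mem fun x _ => NonUnitalSubalgebra.le_topologicalClosure _ (L_ofVertex_mem x)

/-- A *-homomorphism between C*-algebras is automatically continuous, so generators suffice. -/
theorem map_mem_quiverAlgebra {W : Type*} [Quiver W]
    (α : (Fock W →L[ℂ] Fock W) →⋆ₙₐ[ℂ] (Fock V →L[ℂ] Fock V))
    (hα : ∀ T ∈ generators W, α T ∈ quiverAlgebra V) {T : Fock W →L[ℂ] Fock W}
    (hT : T ∈ quiverAlgebra W) : α T ∈ quiverAlgebra V := by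
  have hcont : Continuous α := map_continuous α
  have hle : quiverAlgebra W ≤ (quiverAlgebra V).comap (α : _ →ₙₐ[ℂ] _) := by
    refine NonUnitalSubalgebra.topologicalClosure_minimal (NonUnitalAlgebra.adjoin_le hα) ?_
    exact (NonUnitalSubalgebra.isClosed_topologicalClosure _).preimage hcont
  exact hle hT

theorem map_mem_generatedCStarAlgebra {W : Type*} [Quiver W]
    (α : (Fock W →L[ℂ] Fock W) →⋆ₙₐ[ℂ] (Fock V →L[ℂ] Fock V))
    (hα : ∀ T ∈ generators W, α T ∈ quiverAlgebra V) {T : Fock W →L[ℂ] Fock W}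
    (hT : T ∈ generatedCStarAlgebra W) : α T ∈ generatedCStarAlgebra V := by
  have hcont : Continuous α := map_continuous α
  have hle : generatedCStarAlgebra W ≤ (generatedCStarAlgebra V).comap α := by
    refine NonUnitalStarSubalgebra.topologicalClosure_minimal _
      (NonUnitalStarAlgebra.adjoin_le fun T hT => ?_) ?_
    · exact quiverAlgebra_le_generatedCStarAlgebra (map_mem_quiverAlgebra α hα hT)
    · exact (NonUnitalStarSubalgebra.isClosed_topologicalClosure _).preimage hcont
  exact hle hT

/-- Sorting paths by the wandering path they come from splits the Fock space into copies of the
two-loop one, on each of which `S i` acts as the `i`-th creation operator. -/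
theorem isUnitallyPartlyFree_of_shifts [Finite V] [Nonempty V]
    (σ : Fin 2 → FreeSemigroupoid V → FreeSemigroupoid V)
    (hσ : ∀ i i' j j', σ i j = σ i' j' → i = i' ∧ j = j')
    (hlen : ∀ i j, j.path.length < (σ i j).path.length)
    (S : Fin 2 → Fock V →L[ℂ] Fock V) (hS : ∀ i, S i ∈ quiverAlgebra V)
    (hSσ : ∀ i j, S i (basisVec j) = basisVec (σ i j)) : IsUnitallyPartlyFree V := by
  have hbij := wordAction_bijective hσ (fun j => j.path.length) hlen
  have hinj (r : Wandering σ) : Function.Injective fun w : FreeSemigroupoid TwoLoops =>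
      wordAction σ w.path (r : FreeSemigroupoid V) :=
    fun w w' h => (wordAction_injective hσ _ _ r r h).2
  have hsum := isHilbertSum_inclusion
    (fun (r : Wandering σ) (w : FreeSemigroupoid TwoLoops) =>
      wordAction σ w.path (r : FreeSemigroupoid V))
    hinj hbij
  -- Without a summand the amplification would not be injective. A vertex has length 0, so it is no
  -- value of the lengthening maps.
  have : Nonempty (Wandering σ) := by
    obtain ⟨x⟩ := ‹Nonempty V›
    refine ⟨⟨FreeSemigroupoid.ofVertex x, fun i k h => ?_⟩⟩
    have := hlen i k
    rw [h] at this
    exact absurd this (Nat.not_lt_zero _)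
  set α := amplification hsum with hα
  have hvertex (x : TwoLoops) : L (FreeSemigroupoid.ofVertex x) = 1 := by
    refine clm_ext_basisVec ?_
    rintro ⟨a, b, p⟩
    exact L_mk_basisVec p Quiver.Path.nil
  have hedge (a b : TwoLoops) (e : a ⟶ b) : α (L (FreeSemigroupoid.ofEdge e)) = S e := by
    refine clm_ext_basisVec fun j => ?_
    obtain ⟨⟨r, ⟨c, d, w⟩⟩, rfl⟩ := hbij.2 j
    obtain rfl : d = a := rfl
    have h := amplification_apply hsum (L (FreeSemigroupoid.ofEdge e)) r (basisVec ⟨c, d, w⟩)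
    rw [FreeSemigroupoid.ofEdge, L_mk_basisVec, inclusion_basisVec, inclusion_basisVec] at h
    rw [hSσ]
    exact h.trans (congrArg _ (wordAction_cons σ w e r))
  have hgen : ∀ T ∈ generators TwoLoops, α T ∈ quiverAlgebra V := by
    rintro T (⟨a, b, e, rfl⟩ | ⟨x, rfl⟩)
    · rw [hedge]
      exact hS e
    · rw [hvertex, hα, amplification_one]
      exact one_mem_quiverAlgebra
  refine ⟨NonUnitalStarAlgHom.codRestrict
    (α.comp (NonUnitalStarSubalgebraClass.subtype (generatedCStarAlgebra TwoLoops)))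
    (generatedCStarAlgebra V) fun T => map_mem_generatedCStarAlgebra α hgen T.2, ?_, ?_, ?_⟩
  · intro T T' h
    exact Subtype.ext (amplification_injective hsum (congrArg Subtype.val h))
  · intro T hT
    exact map_mem_quiverAlgebra α hgen hT
  · exact ⟨⟨1, quiverAlgebra_le_generatedCStarAlgebra one_mem_quiverAlgebra⟩, rfl,
      amplification_one hsum⟩

end PartlyFree

/-! ### Paths ending in cycles -/

section Cycles

variable {V : Type u} [Quiver.{v} V]

/-- Two final segments of one path are nested: cancel last edges until the shorter is exhausted. -/
theorem exists_comp_of_comp_eq {a x x' y : V} (q : Quiver.Path a x) (c : Quiver.Path x y)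
    (q' : Quiver.Path a x') (c' : Quiver.Path x' y) (h : q.comp c = q'.comp c')
    (hl : c.length ≤ c'.length) : ∃ r : Quiver.Path x' x, c' = r.comp c ∧ q = q'.comp r := by
  induction c with
  | nil => exact ⟨c', rfl, h⟩
  | cons c e ih =>
    cases c' with
    | nil => simp at hl
    | cons c' e' =>
      rw [Quiver.Path.comp_cons, Quiver.Path.comp_cons] at h
      obtain rfl := Quiver.Path.obj_eq_of_cons_eq_cons h
      obtain rfl := eq_of_heq (Quiver.Path.hom_heq_of_cons_eq_cons h)
      obtain ⟨r, rfl, hr⟩ := ih c' (eq_of_heq (Quiver.Path.heq_of_cons_eq_cons h)) (by simpa using hl)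
      exact ⟨r, rfl, hr⟩

/-- The first edge of `c` has source `y`, so in a cycle nothing may precede it. -/
theorem IsCycleAt.eq_nil {y : V} {c r : Quiver.Path y y} (hc : 0 < c.length)
    (h : IsCycleAt (r.comp c)) : r = Quiver.Path.nil := by
  obtain ⟨z, e, c₀, -, rfl⟩ := c.eq_toPath_comp_of_length_eq_succ (n := c.length - 1) (by omega)
  refine r.eq_nil_of_length_zero (h.2 z r e c₀ ?_)
  rw [← Quiver.Path.comp_assoc, Quiver.Path.comp_toPath_eq_cons]

/-- The cycles at a vertex form a suffix code: none is a proper final segment of another. -/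
theorem IsCycleAt.comp_inj {a y : V} {c c' : Quiver.Path y y} (hc : IsCycleAt c)
    (hc' : IsCycleAt c') {q q' : Quiver.Path a y} (h : q.comp c = q'.comp c') :
    c = c' ∧ q = q' := by
  rcases le_total c.length c'.length with hl | hl
  · obtain ⟨r, rfl, rfl⟩ := exists_comp_of_comp_eq q c q' c' h hl
    obtain rfl := IsCycleAt.eq_nil hc.1 hc'
    simp
  · obtain ⟨r, rfl, rfl⟩ := exists_comp_of_comp_eq q' c' q c h.symm hl
    obtain rfl := IsCycleAt.eq_nil hc'.1 hc
    simp

/-- The `n`-th power of a closed path. -/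
def loopPow {y : V} (c : Quiver.Path y y) : ℕ → Quiver.Path y y
  | 0 => Quiver.Path.nil
  | n + 1 => (loopPow c n).comp c

/-- Decode from the end: strip copies of `c` until `d` appears. The suffix code property prevents
confusing the two. -/
theorem comp_loopPow_inj {a y : V} {c d : Quiver.Path y y} (hc : IsCycleAt c) (hd : IsCycleAt d)
    (hcd : c ≠ d) {q q' : Quiver.Path a y} {k k' : ℕ}
    (h : (q.comp d).comp (loopPow c k) = (q'.comp d).comp (loopPow c k')) : q = q' ∧ k = k' := by
  induction k generalizing k' with
  | zero =>
    cases k' with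
    | zero => exact ⟨(hd.comp_inj hd h).2, rfl⟩
    | succ k' =>
      rw [loopPow, loopPow, ← Quiver.Path.comp_assoc] at h
      exact absurd (hd.comp_inj hc h).1.symm hcd
  | succ k ih =>
    cases k' with
    | zero =>
      rw [loopPow, loopPow, ← Quiver.Path.comp_assoc] at h
      exact absurd (hc.comp_inj hd h).1 hcd
    | succ k' =>
      rw [loopPow, loopPow, ← Quiver.Path.comp_assoc, ← Quiver.Path.comp_assoc] at h
      obtain ⟨h1, h2⟩ := ih (hc.comp_inj hc h).2
      exact ⟨h1, congrArg _ h2⟩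

end Cycles

/-! ### The double-cycle property gives partly free algebras -/

section Sufficiency

variable {V : Type u} [Quiver.{v} V]

theorem isUnitallyPartlyFree_of_doubleCycles [Nonempty V] [Finite V]
    (h : UniformDoubleCycleProperty V) : IsUnitallyPartlyFree V := by
  have := Fintype.ofFinite V
  have h1 (x : V) : ∃ y : {y : V // HasDoubleCycleAt y}, Nonempty (Quiver.Path x y) := by
    obtain ⟨y, hxy, hy⟩ := h x
    exact ⟨⟨y, hy⟩, hxy⟩
  choose Y hY using h1
  have p (x : V) : Quiver.Path x (Y x) := (hY x).some
  choose c d hc hd hcd using fun y : {y : V // HasDoubleCycleAt y} => y.2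
  -- The exponents must separate vertices as well as the two isometries, since different `x` may
  -- share the same `Y x`.
  obtain ⟨k, hk⟩ : ∃ k : Fin 2 × V → ℕ, Function.Injective k :=
    ⟨fun x => Fintype.equivFin _ x, Fin.val_injective.comp (Equiv.injective _)⟩
  have hcode {a a' : V} {y y' : {y : V // HasDoubleCycleAt y}} {q : Quiver.Path a y}
      {q' : Quiver.Path a' y'} {n n' : ℕ}
      (h : (⟨a, y, (q.comp (d y)).comp (loopPow (c y) n)⟩ : FreeSemigroupoid V) =
        ⟨a', y', (q'.comp (d y')).comp (loopPow (c y') n')⟩) :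
      (⟨a, y, q⟩ : FreeSemigroupoid V) = ⟨a', y', q'⟩ ∧ n = n' := by
    obtain rfl : a = a' := congrArg FreeSemigroupoid.source h
    obtain rfl : y = y' := Subtype.ext (congrArg FreeSemigroupoid.target h)
    simp only [FreeSemigroupoid.mk.injEq, heq_eq_eq, true_and] at h
    obtain ⟨rfl, rfl⟩ := comp_loopPow_inj (hc y) (hd y) (hcd y) h
    exact ⟨rfl, rfl⟩
  let u (i : Fin 2) (x : V) : Quiver.Path x (Y x) :=
    ((p x).comp (d (Y x))).comp (loopPow (c (Y x)) (k (i, x)))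
  let S (i : Fin 2) : Fock V →L[ℂ] Fock V := ∑ x : V, L ⟨x, Y x, u i x⟩
  refine isUnitallyPartlyFree_of_shifts (fun i w => ⟨w.source, Y w.target, w.path.comp (u i w.target)⟩)
    ?_ ?_ S ?_ ?_
  · rintro i i' ⟨a, x, q⟩ ⟨a', x', q'⟩ h
    simp only [u, ← Quiver.Path.comp_assoc] at h
    obtain ⟨h1, h2⟩ := hcode h
    obtain ⟨rfl, rfl⟩ := Prod.ext_iff.1 (hk h2)
    simp only [FreeSemigroupoid.mk.injEq, true_and] at h1
    obtain ⟨rfl, h1⟩ := h1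
    rw [heq_eq_eq, Quiver.Path.comp_inj_left] at h1
    exact ⟨rfl, by rw [h1]⟩
  · rintro i ⟨a, x, q⟩
    have := (hd (Y x)).1
    simp only [u, Quiver.Path.length_comp]
    omega
  · intro i
    exact sum_mem fun x _ => NonUnitalSubalgebra.le_topologicalClosure _ (L_mem _)
  · rintro i ⟨a, x, q⟩
    simp only [S]
    rw [_root_.sum_apply, Finset.sum_eq_single x]
    · exact L_mk_basisVec q (u i x)
    · intro y _ hy
      exact L_basisVec_of_ne hy.symm
    · simp

/-! ### Orthogonal isometries from a partly free algebra -/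

open Classical in
theorem adjoint_L_ofEdge_comp_L_ofEdge {a b b' : TwoLoops} (e : a ⟶ b) (f : a ⟶ b') :
    ContinuousLinearMap.adjoint (L (FreeSemigroupoid.ofEdge e)) *
      L (FreeSemigroupoid.ofEdge f) = if e = f then 1 else 0 := by
  refine clm_ext_basisVec ?_
  rintro ⟨c, d, p⟩
  refine (lp.ext ?_)
  ext ⟨c', d', p'⟩
  rw [← inner_basisVec, ← inner_basisVec, mul_apply_eq_comp,
    ContinuousLinearMap.adjoint_inner_right]
  obtain rfl : d = a := rfl
  obtain rfl : d' = d := rfl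
  obtain rfl : b' = b := rfl
  obtain rfl : c' = c := rfl
  rw [FreeSemigroupoid.ofEdge, FreeSemigroupoid.ofEdge, L_mk_basisVec, L_mk_basisVec]
  rw [inner_basisVec, basisVec_apply]
  by_cases h : e = f
  · subst h
    simp [inner_basisVec, basisVec_apply]
  · simp [h]

theorem IsUnitallyPartlyFree.exists_isometries (h : IsUnitallyPartlyFree V) :
    ∃ S T : Fock V →L[ℂ] Fock V, S ∈ quiverAlgebra V ∧ T ∈ quiverAlgebra V ∧
      Isometry S ∧ Isometry T ∧ ContinuousLinearMap.adjoint S ∘L T = 0 := by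
  obtain ⟨φ, -, hφ, I, hI, hφI⟩ := h
  let e (i : Fin 2) : Quiver.SingleObj.star (Fin 2) ⟶ Quiver.SingleObj.star (Fin 2) := i
  have hmem (i : Fin 2) : L (FreeSemigroupoid.ofEdge (e i)) ∈ quiverAlgebra TwoLoops :=
    NonUnitalSubalgebra.le_topologicalClosure _
      (NonUnitalAlgebra.subset_adjoin ℂ (Or.inl ⟨_, _, e i, rfl⟩))
  let s (i : Fin 2) : generatedCStarAlgebra TwoLoops :=
    ⟨_, quiverAlgebra_le_generatedCStarAlgebra (hmem i)⟩
  have hstar (i j : Fin 2) : star (s i) * s j = if i = j then I else 0 := by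
    refine Subtype.ext ((adjoint_L_ofEdge_comp_L_ofEdge (e i) (e j)).trans ?_)
    by_cases h : i = j
    · rw [if_pos (congrArg e h), if_pos h, hI]
    · rw [if_neg h, if_neg h]
      rfl
  have hmul (i j : Fin 2) : star (φ (s i) : Fock V →L[ℂ] Fock V) * (φ (s j) : Fock V →L[ℂ] Fock V)
      = if i = j then 1 else 0 := by
    have := congrArg (fun T => (φ T : Fock V →L[ℂ] Fock V)) (hstar i j)
    simp only [map_mul, map_star] at this
    refine Eq.trans this ?_
    split_ifs
    · exact hφI
    · simp
  have hiso (i : Fin 2) : Isometry (φ (s i) : Fock V →L[ℂ] Fock V) := by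
    rw [ContinuousLinearMap.isometry_iff_adjoint_comp_self]
    exact (hmul i i).trans (if_pos rfl)
  exact ⟨φ (s 0), φ (s 1), hφ _ (hmem 0), hφ _ (hmem 1), hiso 0, hiso 1,
    (hmul 0 1).trans (if_neg (by decide))⟩

end Sufficiency

/-! ### Graphs without double-cycles -/

section Graph

variable {V : Type u} [Quiver.{v} V]

/-- The tails have equal length, so the segment by which they differ is empty. Edges are compared in
a sigma type because their endpoints are not known to agree beforehand. -/
theorem edge_eq_of_toPath_comp_eq {x y z w : V} {e : x ⟶ y} {f : x ⟶ z} {p : Quiver.Path y w}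
    {q : Quiver.Path z w} (h : e.toPath.comp p = f.toPath.comp q) :
    (⟨y, e⟩ : Σ b, x ⟶ b) = ⟨z, f⟩ := by
  have hlen : p.length = q.length := by
    have := congrArg Quiver.Path.length h
    simpa [Quiver.Path.length_comp] using this
  obtain ⟨r, rfl, hr⟩ := exists_comp_of_comp_eq _ _ _ _ h hlen.le
  have hr0 : r.length = 0 := by
    rw [Quiver.Path.length_comp] at hlen
    omega
  obtain rfl := r.eq_of_length_zero hr0
  obtain rfl := r.eq_nil_of_length_zero hr0
  rw [eq_of_heq (Quiver.Path.hom_heq_of_cons_eq_cons hr)]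

/-- An edge out of `x` followed by a shortest path back to `x` is a cycle at `x`. -/
theorem exists_isCycleAt_of_edge {x y : V} (e : x ⟶ y) (h : Nonempty (Quiver.Path y x)) :
    ∃ p : Quiver.Path y x, IsCycleAt (e.toPath.comp p) := by
  obtain ⟨p, -, hp⟩ := WellFounded.has_min
    (measure (Quiver.Path.length : Quiver.Path y x → ℕ)).wf Set.univ Set.univ_nonempty
  refine ⟨p, by simp [Quiver.Path.length_comp], fun z q f r h => ?_⟩
  by_contra hq
  -- A nonempty `q` must begin with `e`; what remains of it is a path from `y` back to `x` shorter
  -- than the shortest one.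
  obtain ⟨b, e', q', -, rfl⟩ := q.eq_toPath_comp_of_length_eq_succ (n := q.length - 1) (by omega)
  have hlen := congrArg Quiver.Path.length h
  rw [← Quiver.Path.comp_cons, Quiver.Path.comp_assoc] at h
  obtain ⟨rfl, -⟩ := Sigma.mk.inj_iff.1 (edge_eq_of_toPath_comp_eq h)
  refine hp q' trivial ?_
  change q'.length < p.length
  simp only [Quiver.Path.length_comp, Quiver.Path.length_cons, Quiver.Path.length_toPath] at hlen
  omega

/-- Distinct edges from a vertex to vertices from which one can return give a double-cycle. -/
theorem hasDoubleCycleAt_of_edges {x y z : V} (e : x ⟶ y) (f : x ⟶ z)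
    (hy : Nonempty (Quiver.Path y x)) (hz : Nonempty (Quiver.Path z x))
    (hne : (⟨y, e⟩ : Σ b, x ⟶ b) ≠ ⟨z, f⟩) : HasDoubleCycleAt x := by
  obtain ⟨p, hp⟩ := exists_isCycleAt_of_edge e hy
  obtain ⟨q, hq⟩ := exists_isCycleAt_of_edge f hz
  exact ⟨_, _, hp, hq, fun h => hne (edge_eq_of_toPath_comp_eq h)⟩

theorem satVertices_subset {x y : V} (h : y ∈ satVertices x) : satVertices y ⊆ satVertices x :=
  fun _ hz => ⟨h.some.comp hz.some⟩

/-- In a finite graph, if the saturation at `x` has no double-cycle, then some vertex of it has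
a saturation in which there is at most one edge from every vertex. -/
theorem exists_subsingleton_edges [Finite V] {x : V} (h : ¬ SatIncludesDoubleCycle x) :
    ∃ y : V, ∀ z ∈ satVertices y, Subsingleton (Σ b, z ⟶ b) := by
  -- With the saturation of `y` as small as possible, every vertex reachable from `y` has that same
  -- saturation and so leads back. Two edges out of one vertex would then close up to a
  -- double-cycle.
  obtain ⟨y, hy, hmin⟩ := WellFounded.has_min
    (measure fun y : V => (satVertices y).ncard).wf (satVertices x) ⟨x, ⟨Quiver.Path.nil⟩⟩
  refine ⟨y, fun z hz => ⟨fun ⟨b, e⟩ ⟨c, f⟩ => ?_⟩⟩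
  have hback {b : V} (e : z ⟶ b) : Nonempty (Quiver.Path b z) := by
    have hb : b ∈ satVertices y := satVertices_subset hz ⟨e.toPath⟩
    have heq : satVertices b = satVertices y :=
      Set.eq_of_subset_of_ncard_le (satVertices_subset hb)
        (not_lt.1 (hmin b (satVertices_subset hy hb))) (Set.toFinite _)
    change z ∈ satVertices b
    rwa [heq]
  by_contra hne
  exact h ⟨z, satVertices_subset hy hz, hasDoubleCycleAt_of_edges e f (hback e) (hback f) hne⟩

theorem path_eq_of_length_eq {y : V} (h : ∀ z ∈ satVertices y, Subsingleton (Σ b, z ⟶ b))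
    {a b : V} (p : Quiver.Path y a) (q : Quiver.Path y b) (hl : p.length = q.length) :
    (⟨y, a, p⟩ : FreeSemigroupoid V) = ⟨y, b, q⟩ := by
  induction p generalizing b with
  | nil =>
    cases q with
    | nil => rfl
    | cons q f => simp at hl
  | @cons c d p e ih =>
    cases q with
    | nil => simp at hl
    | cons q f =>
      have h1 := ih q (by simpa using hl)
      simp only [FreeSemigroupoid.mk.injEq, true_and] at h1
      obtain ⟨rfl, h1⟩ := h1
      obtain rfl := eq_of_heq h1
      have h2 := (h c ⟨p⟩).elim ⟨_, e⟩ ⟨_, f⟩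
      obtain ⟨rfl, h2⟩ := Sigma.mk.inj_iff.1 h2
      rw [eq_of_heq h2]

end Graph

/-! ### Isometries with orthogonal ranges in a quiver algebra -/

section Necessity

variable {V : Type u} [Quiver.{v} V]

theorem exists_adjoin_norm_sub_lt {T : Fock V →L[ℂ] Fock V} (hT : T ∈ quiverAlgebra V) {ε : ℝ}
    (hε : 0 < ε) : ∃ A ∈ NonUnitalAlgebra.adjoin ℂ (generators V), ‖T - A‖ < ε := by
  obtain ⟨A, hA, h⟩ := Metric.mem_closure_iff.1 hT ε hε
  exact ⟨A, hA, by rwa [← dist_eq_norm]⟩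

/-- Whether a generator kills a path depends only on the path's final vertex, and in a product the
factor applied first decides. -/
theorem exists_finite_vanishing {A : Fock V →L[ℂ] Fock V}
    (hA : A ∈ NonUnitalAlgebra.adjoin ℂ (generators V)) :
    ∃ F : Set V, F.Finite ∧ ∀ w : FreeSemigroupoid V, w.target ∉ F → A (basisVec w) = 0 := by
  induction hA using NonUnitalAlgebra.adjoin_induction with
  | mem A hA =>
    obtain ⟨a, b, e, rfl⟩ | ⟨x, rfl⟩ := hA
    · exact ⟨{a}, Set.finite_singleton a, fun w hw => L_basisVec_of_ne hw⟩
    · exact ⟨{x}, Set.finite_singleton x, fun w hw => L_basisVec_of_ne hw⟩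
  | add A B _ _ hA hB =>
    obtain ⟨F, hF, hA⟩ := hA
    obtain ⟨F', hF', hB⟩ := hB
    refine ⟨F ∪ F', hF.union hF', fun w hw => ?_⟩
    rw [add_apply, hA w fun h => hw (Or.inl h), hB w fun h => hw (Or.inr h), add_zero]
  | zero => exact ⟨∅, Set.finite_empty, fun w _ => rfl⟩
  | mul A B _ _ _ hB =>
    obtain ⟨F, hF, hB⟩ := hB
    exact ⟨F, hF, fun w hw => by rw [mul_apply_eq_comp, hB w hw, map_zero]⟩
  | smul r A _ hA =>
    obtain ⟨F, hF, hA⟩ := hA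
    exact ⟨F, hF, fun w hw => by rw [smul_apply, hA w hw, smul_zero]⟩

/-- At a vertex outside the finite set, `S - A` agrees with `S` and so has norm at least 1, against
the choice of `A`. -/
theorem finite_of_isometry_mem {S : Fock V →L[ℂ] Fock V} (hS : S ∈ quiverAlgebra V)
    (hiso : Isometry S) : Finite V := by
  obtain ⟨A, hA, hSA⟩ := exists_adjoin_norm_sub_lt hS one_pos
  obtain ⟨F, hF, hvan⟩ := exists_finite_vanishing hA
  suffices h : F = Set.univ from Set.finite_univ_iff.1 (h ▸ hF)
  refine Set.eq_univ_of_forall fun x => ?_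
  by_contra hx
  have h1 := (S - A).le_opNorm (basisVec (FreeSemigroupoid.ofVertex x))
  rw [sub_apply, hvan _ hx, sub_zero, hiso.norm_map_of_map_zero (map_zero S),
    norm_basisVec] at h1
  linarith

/-- The span of the basis vectors of the paths of length less than `n` with source `y`. -/
def pathSpan (y : V) (n : ℕ) : Submodule ℂ (Fock V) :=
  Submodule.span ℂ (basisVec '' {w : FreeSemigroupoid V | w.source = y ∧ w.path.length < n})

theorem basisVec_mem_pathSpan {y b : V} (p : Quiver.Path y b) {n : ℕ} (h : p.length < n) :
    basisVec ⟨y, b, p⟩ ∈ pathSpan y n :=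
  Submodule.subset_span ⟨_, ⟨rfl, h⟩, rfl⟩

theorem pathSpan_le {y : V} {n : ℕ} {M : Submodule ℂ (Fock V)}
    (h : ∀ (b : V) (p : Quiver.Path y b), p.length < n → basisVec ⟨y, b, p⟩ ∈ M) :
    pathSpan y n ≤ M := by
  refine Submodule.span_le.2 ?_
  rintro _ ⟨⟨a, b, p⟩, ⟨rfl, hp⟩, rfl⟩
  exact h b p hp

theorem pathSpan_mono (y : V) {m n : ℕ} (h : m ≤ n) : pathSpan y m ≤ pathSpan y n :=
  pathSpan_le fun _ p hp => basisVec_mem_pathSpan p (hp.trans_le h)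

theorem L_mem_pathSpan {a b : V} (q : Quiver.Path a b) {y : V} {n : ℕ} {f : Fock V}
    (hf : f ∈ pathSpan y n) : L ⟨a, b, q⟩ f ∈ pathSpan y (n + q.length) := by
  have : pathSpan y n ≤
      (pathSpan y (n + q.length)).comap (L ⟨a, b, q⟩ : Fock V →ₗ[ℂ] Fock V) := by
    refine pathSpan_le fun c p hp => ?_
    change L ⟨a, b, q⟩ (basisVec ⟨y, c, p⟩) ∈ pathSpan y (n + q.length)
    by_cases h : c = a
    · subst h
      rw [L_mk_basisVec]
      exact basisVec_mem_pathSpan _ (by rw [Quiver.Path.length_comp]; omega)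
    · rw [L_basisVec_of_ne h]
      exact zero_mem _
  exact this hf

/-- The elements of the algebra generated by the `L_e` and `L_x` increase the lengths of paths by
a bounded amount. -/
theorem exists_pathSpan_shift {A : Fock V →L[ℂ] Fock V}
    (hA : A ∈ NonUnitalAlgebra.adjoin ℂ (generators V)) :
    ∃ N : ℕ, ∀ (y : V) (n : ℕ), ∀ f ∈ pathSpan y n, A f ∈ pathSpan y (n + N) := by
  induction hA using NonUnitalAlgebra.adjoin_induction with
  | mem A hA =>
    obtain ⟨a, b, e, rfl⟩ | ⟨x, rfl⟩ := hA
    · exact ⟨_, fun y n f hf => L_mem_pathSpan e.toPath hf⟩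
    · exact ⟨_, fun y n f hf => L_mem_pathSpan (Quiver.Path.nil : Quiver.Path x x) hf⟩
  | add A B _ _ hA hB =>
    obtain ⟨N, hA⟩ := hA
    obtain ⟨N', hB⟩ := hB
    exact ⟨max N N', fun y n f hf => add_mem
      (pathSpan_mono y (by omega) (hA y n f hf)) (pathSpan_mono y (by omega) (hB y n f hf))⟩
  | zero => exact ⟨0, fun y n f _ => zero_mem _⟩
  | mul A B _ _ hA hB =>
    obtain ⟨N, hA⟩ := hA
    obtain ⟨N', hB⟩ := hB
    refine ⟨N' + N, fun y n f hf => ?_⟩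
    rw [← add_assoc]
    exact hA y _ _ (hB y n f hf)
  | smul r A _ hA =>
    obtain ⟨N, hA⟩ := hA
    exact ⟨N, fun y n f hf => Submodule.smul_mem _ r (hA y n f hf)⟩

theorem finrank_pathSpan_le {y : V} (h : ∀ z ∈ satVertices y, Subsingleton (Σ b, z ⟶ b)) (n : ℕ) :
    FiniteDimensional ℂ (pathSpan y n) ∧ Module.finrank ℂ (pathSpan y n) ≤ n := by
  have hinj : Set.InjOn (fun w : FreeSemigroupoid V => w.path.length)
      {w | w.source = y ∧ w.path.length < n} := by
    rintro ⟨a, b, p⟩ ⟨rfl, _⟩ ⟨a', b', p'⟩ ⟨h', _⟩ hl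
    dsimp only at h'
    subst h'
    exact path_eq_of_length_eq h p p' hl
  have hmaps : Set.MapsTo (fun w : FreeSemigroupoid V => w.path.length)
      {w | w.source = y ∧ w.path.length < n} (Set.Iio n) := fun w hw => hw.2
  have hfin : {w : FreeSemigroupoid V | w.source = y ∧ w.path.length < n}.Finite :=
    Set.Finite.of_injOn hmaps hinj (Set.finite_Iio n)
  have hcard : {w : FreeSemigroupoid V | w.source = y ∧ w.path.length < n}.ncard ≤ n := by
    refine (Set.ncard_le_ncard_of_injOn _ hmaps hinj (Set.finite_Iio n)).trans_eq ?_
    simp [Set.ncard_eq_toFinset_card']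
  refine ⟨FiniteDimensional.span_of_finite ℂ (hfin.image _), ?_⟩
  have := (hfin.image (basisVec : _ → Fock V)).fintype
  refine (finrank_span_le_card _).trans ?_
  rw [← Set.ncard_eq_toFinset_card']
  exact (Set.ncard_image_le hfin).trans hcard

theorem norm_add_sq_of_adjoint_comp_eq_zero {H : Type*} [NormedAddCommGroup H]
    [InnerProductSpace ℂ H] [CompleteSpace H] {S T : H →L[ℂ] H} (hS : Isometry S)
    (hT : Isometry T) (hST : ContinuousLinearMap.adjoint S ∘L T = 0) (f g : H) :
    ‖S f + T g‖ * ‖S f + T g‖ = ‖f‖ * ‖f‖ + ‖g‖ * ‖g‖ := by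
  rw [norm_add_sq_eq_norm_sq_add_norm_sq_of_inner_eq_zero (𝕜 := ℂ),
    hS.norm_map_of_map_zero (map_zero S), hT.norm_map_of_map_zero (map_zero T)]
  rw [← ContinuousLinearMap.adjoint_inner_right, ← ContinuousLinearMap.comp_apply, hST]
  simp

/-- The map `(f, g) ↦ A f + B g` is injective: `S f + T g` has squared norm `‖f‖² + ‖g‖²`, too large
for the approximation error to cancel. -/
theorem two_mul_finrank_pathSpan_le {S T A B : Fock V →L[ℂ] Fock V} (hS : Isometry S)
    (hT : Isometry T) (hST : ContinuousLinearMap.adjoint S ∘L T = 0) (hSA : ‖S - A‖ < 1 / 2)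
    (hTB : ‖T - B‖ < 1 / 2) {y : V} {m n : ℕ} [FiniteDimensional ℂ (pathSpan y m)]
    [FiniteDimensional ℂ (pathSpan y n)] (hA : ∀ f ∈ pathSpan y m, A f ∈ pathSpan y n)
    (hB : ∀ f ∈ pathSpan y m, B f ∈ pathSpan y n) :
    2 * Module.finrank ℂ (pathSpan y m) ≤ Module.finrank ℂ (pathSpan y n) := by
  let Φ : pathSpan y m × pathSpan y m →ₗ[ℂ] pathSpan y n :=
    ((A : Fock V →ₗ[ℂ] Fock V).restrict hA).coprod ((B : Fock V →ₗ[ℂ] Fock V).restrict hB)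
  have hΦ : Function.Injective Φ := by
    refine (injective_iff_map_eq_zero Φ).2 ?_
    rintro ⟨f, g⟩ h
    have h0 : A (f : Fock V) + B (g : Fock V) = 0 := congrArg Subtype.val h
    have h1 := norm_add_sq_of_adjoint_comp_eq_zero hS hT hST (f : Fock V) (g : Fock V)
    have h2 : S (f : Fock V) + T (g : Fock V) = (S - A) f + (T - B) g := by
      rw [sub_apply, sub_apply, sub_add_sub_comm, h0, sub_zero]
    have h3 : ‖S (f : Fock V) + T (g : Fock V)‖ ≤ 1 / 2 * (‖(f : Fock V)‖ + ‖(g : Fock V)‖) := by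
      rw [h2, mul_add]
      exact (norm_add_le _ _).trans (add_le_add ((S - A).le_of_opNorm_le hSA.le _)
        ((T - B).le_of_opNorm_le hTB.le _))
    have h4 := mul_self_le_mul_self (norm_nonneg _) h3
    -- The constant 1/2 works because `(‖f‖ + ‖g‖)² / 4 ≤ (‖f‖² + ‖g‖²) / 2`, which forces both
    -- norms to vanish.
    have hf : ‖(f : Fock V)‖ = 0 := by
      nlinarith [sq_nonneg (‖(f : Fock V)‖ - ‖(g : Fock V)‖), norm_nonneg (f : Fock V),
        norm_nonneg (g : Fock V)]
    have hg : ‖(g : Fock V)‖ = 0 := by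
      nlinarith [sq_nonneg (‖(f : Fock V)‖ - ‖(g : Fock V)‖), norm_nonneg (f : Fock V),
        norm_nonneg (g : Fock V)]
    exact Prod.ext (Subtype.ext (norm_eq_zero.1 hf)) (Subtype.ext (norm_eq_zero.1 hg))
  have := LinearMap.finrank_le_finrank_of_injective hΦ
  rw [Module.finrank_prod] at this
  omega

theorem uniformDoubleCycleProperty_of_isometries [Finite V] {S T : Fock V →L[ℂ] Fock V}
    (hS : S ∈ quiverAlgebra V) (hT : T ∈ quiverAlgebra V) (hSi : Isometry S) (hTi : Isometry T)
    (hST : ContinuousLinearMap.adjoint S ∘L T = 0) : UniformDoubleCycleProperty V := by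
  intro x
  by_contra hx
  obtain ⟨y, hy⟩ := exists_subsingleton_edges hx
  obtain ⟨A, hA, hSA⟩ := exists_adjoin_norm_sub_lt hS (half_pos one_pos)
  obtain ⟨B, hB, hTB⟩ := exists_adjoin_norm_sub_lt hT (half_pos one_pos)
  obtain ⟨N, hAN⟩ := exists_pathSpan_shift hA
  obtain ⟨N', hBN⟩ := exists_pathSpan_shift hB
  have hfd (n : ℕ) := (finrank_pathSpan_le hy n).1
  have hstep (n : ℕ) : 2 * Module.finrank ℂ (pathSpan y n) ≤
      Module.finrank ℂ (pathSpan y (n + (N + N'))) :=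
    two_mul_finrank_pathSpan_le hSi hTi hST hSA hTB
      (fun f hf => pathSpan_mono y (by omega) (hAN y n f hf))
      (fun f hf => pathSpan_mono y (by omega) (hBN y n f hf))
  have hpow (k : ℕ) : 2 ^ k ≤ Module.finrank ℂ (pathSpan y (1 + k * (N + N'))) := by
    induction k with
    | zero =>
      rw [pow_zero, Nat.one_le_iff_ne_zero, Ne, Submodule.finrank_eq_zero]
      intro h
      have h1 : basisVec (FreeSemigroupoid.ofVertex y) ∈ pathSpan y (1 + 0 * (N + N')) :=
        basisVec_mem_pathSpan _ (by simp)
      rw [h, Submodule.mem_bot, ← norm_eq_zero, norm_basisVec] at h1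
      exact one_ne_zero h1
    | succ k ih =>
      have := hstep (1 + k * (N + N'))
      rw [add_assoc, ← Nat.succ_mul] at this
      rw [pow_succ]
      exact (by omega : _ ≤ 2 * _).trans this
  -- With `D = N + N'` and `a = 2 * D + 1`, taking `k = 2 * a` makes `2 ^ k` the square of `2 ^ a >
  -- a`, hence larger than `a ^ 2 ≥ 1 + k * D`.
  have h1 := (hpow (2 * (2 * (N + N') + 1))).trans (finrank_pathSpan_le hy _).2
  have h2 : 2 * (N + N') + 1 < 2 ^ (2 * (N + N') + 1) := Nat.lt_two_pow_self
  rw [two_mul, pow_add] at h1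
  nlinarith

end Necessity

end QuiverAlg

end

theorem mainTheorem4 (V : Type u) [Quiver.{v} V] [Nonempty V] [Countable V]
    [∀ a b : V, Countable (a ⟶ b)] :
    List.TFAE
      [Finite V ∧ QuiverAlg.UniformDoubleCycleProperty V,
        QuiverAlg.IsUnitallyPartlyFree V,
        ∃ S T : QuiverAlg.Fock V →L[ℂ] QuiverAlg.Fock V,
          S ∈ QuiverAlg.quiverAlgebra V ∧ T ∈ QuiverAlg.quiverAlgebra V ∧
          Isometry S ∧ Isometry T ∧ ContinuousLinearMap.adjoint S ∘L T = 0] := by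
  tfae_have 1 → 2 := fun ⟨_, h⟩ => QuiverAlg.isUnitallyPartlyFree_of_doubleCycles h
  tfae_have 2 → 3 := QuiverAlg.IsUnitallyPartlyFree.exists_isometries
  tfae_have 3 → 1 := by
    rintro ⟨S, T, hS, hT, hSi, hTi, hST⟩
    have := QuiverAlg.finite_of_isometry_mem hS hSi
    exact ⟨this, QuiverAlg.uniformDoubleCycleProperty_of_isometries hS hT hSi hTi hST⟩
  tfae_finish
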